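/- Let $n\ge 1$ and $k\ge 0$ be integers, $m=2k$, and let $V$ be a real Euclidean space of dimension $n$ with orthonormal basis $e_1,\dots,e_n$ and orthogonal group $O(V)\cong O(n)$. Equip $V^{\otimes m}$ with the diagonal action of $O(V)$ and with the inner product determined by $\langle x_1\otimes\cdots\otimes x_m,\,y_1\otimes\cdots\otimes y_m\rangle=\prod_{i}\langle x_i,y_i\rangle$, and let $\mathcal I_m\subset V^{\otimes m}$ be the subspace of $O(V)$-invariant tensors. Let $\Pi_m$ be the set of pairings of $\{1,\dots,m\}$, i.e. of partitions $\mathcal P=\{J_1,\dots,J_k\}$ into two-element sets. For $\mathcal P\in\Pi_m$ let $$I(\mathcal P)=\sum_{i_1,\dots,i_k=1}^{n} e_{i_1}(J_1)\otimes\cdots\otimes e_{i_k}(J_k),$$ where the summand denotes the decomposable tensor in $V^{\otimes m}$ with the vector $e_{i_r}$ at the two positions in $J_r$, for $r=1,\dots,k$. Put $$A_m=\frac1{|\Pi_m|}\sum_{\mathcal P\in\Pi_m}I(\mathcal P),\qquad P(n,k)=n(n+2)\cdots(n+2k-2),\qquad \mu_{k,n}=\frac{(2k-1)!!}{P(n,k)},$$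 with $P(n,0)=(-1)!!=1$, and let $\mathcal G=(\langle I(\mathcal P),I(\mathcal Q)\rangle)_{\mathcal P,\mathcal Q\in\Pi_m}$ be the Gram matrix of the standard invariants, indexed by pairings. Then: (i) The image of the Veronese surface $\{x^{\otimes m}: x\in V,\ |x|=1\}$ under the orthogonal projection of $V^{\otimes m}$ onto $\mathcal I_m$ is the single point $\mu_{k,n}A_m$. (ii) Every row of $\mathcal G$ has sum $P(n,k)$, and the average of all $|\Pi_m|^2$ entries of $\mathcal G$ is $1/\mu_{k,n}$. (iii) The uniform distribution (normalized surface measure) on the unit sphere of $V$ is an $O(V)$-invariant probability measure; and if $x$ is a random unit vector in $V$ whose law is an $O(V)$-invariant Borel probability measure on the unit sphere, then $x^{\otimes 2k}$ is integrable and $$\mathbb E\bigl(x^{\otimes 2k}\bigr)=\frac1{P(n,k)}\sum_{\mathcal P\in\Pi_m}I(\mathcal P)=\mu_{k,n}A_m .$$ That is, the expectation is the average $A_m$ of the standard invariants divided by the average entry of $\mathcal G$. -/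

import Mathlib

open MeasureTheory
open scoped TensorProduct

noncomputable section

/-- The space `V^{⊗m}` of `m`-tensors over `V`. It is a separate name for Mathlib's tensor power
because it carries the Euclidean structure below and not the projective tensor norm. -/
def TensorSpace (V : Type*) [NormedAddCommGroup V] [InnerProductSpace ℝ V] (m : ℕ) : Type _ :=
  ⨂[ℝ] _ : Fin m, V

namespace TensorSpace

section Algebra

variable {V : Type*} [NormedAddCommGroup V] [InnerProductSpace ℝ V] {m : ℕ}

instance : AddCommGroup (TensorSpace V m) :=
  inferInstanceAs (AddCommGroup (PiTensorProduct ℝ fun _ : Fin m => V))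

instance : Module ℝ (TensorSpace V m) :=
  inferInstanceAs (Module ℝ (PiTensorProduct ℝ fun _ : Fin m => V))

/-- The decomposable tensor `x₁ ⊗ ⋯ ⊗ x_m`. -/
def decomposable (x : Fin m → V) : TensorSpace V m :=
  PiTensorProduct.tprod ℝ x

/-- The diagonal action of `g ∈ O(V)` on `V^{⊗m}`:
`x₁ ⊗ ⋯ ⊗ x_m ↦ g x₁ ⊗ ⋯ ⊗ g x_m`. -/
def act (g : V ≃ₗᵢ[ℝ] V) : TensorSpace V m →ₗ[ℝ] TensorSpace V m :=
  PiTensorProduct.map (R := ℝ) (s := fun _ : Fin m => V) (t := fun _ : Fin m => V)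
    fun _ => g.toLinearEquiv.toLinearMap

/-- The bilinear form on `V^{⊗m}` determined by
`⟨x₁ ⊗ ⋯ ⊗ x_m, y₁ ⊗ ⋯ ⊗ y_m⟩ = ⟨x₁, y₁⟩ ⋯ ⟨x_m, y_m⟩`. -/
def form : TensorSpace V m →ₗ[ℝ] TensorSpace V m →ₗ[ℝ] ℝ :=
  (PiTensorProduct.dualDistrib (R := ℝ) (M := fun _ : Fin m => V)).comp
    (PiTensorProduct.map (R := ℝ) fun _ : Fin m => innerₗ V)

theorem form_decomposable (x y : Fin m → V) :
    form (decomposable x) (decomposable y) = ∏ i, inner ℝ (x i) (y i) := by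
  have h : PiTensorProduct.dualDistrib (R := ℝ) (M := fun _ : Fin m => V)
      (PiTensorProduct.map (fun _ : Fin m => innerₗ V) (PiTensorProduct.tprod ℝ x))
      (PiTensorProduct.tprod ℝ y) = ∏ i, inner ℝ (x i) (y i) := by
    rw [PiTensorProduct.map_tprod, PiTensorProduct.dualDistrib_apply]
    simp
  exact h

theorem hom_ext {W : Type*} [AddCommMonoid W] [Module ℝ W] {f g : TensorSpace V m →ₗ[ℝ] W}
    (h : ∀ x : Fin m → V, f (decomposable x) = g (decomposable x)) : f = g :=
  PiTensorProduct.ext (R := ℝ) (s := fun _ : Fin m => V) (MultilinearMap.ext h)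

theorem form_symm (S T : TensorSpace V m) : form S T = form T S := by
  have h : (form : TensorSpace V m →ₗ[ℝ] TensorSpace V m →ₗ[ℝ] ℝ) = form.flip := by
    refine hom_ext fun x => hom_ext fun y => ?_
    rw [LinearMap.flip_apply, form_decomposable, form_decomposable]
    exact Finset.prod_congr rfl fun i _ => real_inner_comm _ _
  exact congrArg (fun B => B S T) h

end Algebra

variable {V : Type*} [NormedAddCommGroup V] [InnerProductSpace ℝ V] [FiniteDimensional ℝ V] {m : ℕ}

/-- The basis `e_{p₁} ⊗ ⋯ ⊗ e_{p_m}` of `V^{⊗m}`, for one orthonormal basis of `V`; it only serves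
to prove positivity of the form. -/
def auxBasis (V : Type*) [NormedAddCommGroup V] [InnerProductSpace ℝ V] [FiniteDimensional ℝ V]
    (m : ℕ) : Module.Basis (Fin m → Fin (Module.finrank ℝ V)) ℝ (TensorSpace V m) :=
  Basis.piTensorProduct (R := ℝ) (M := fun _ : Fin m => V)
    fun _ => (stdOrthonormalBasis ℝ V).toBasis

theorem auxBasis_apply (p : Fin m → Fin (Module.finrank ℝ V)) :
    auxBasis V m p = decomposable fun i => stdOrthonormalBasis ℝ V (p i) := by
  have h : Basis.piTensorProduct (R := ℝ) (M := fun _ : Fin m => V)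
      (fun _ => (stdOrthonormalBasis ℝ V).toBasis) p =
        PiTensorProduct.tprod ℝ fun i => stdOrthonormalBasis ℝ V (p i) := by
    simp
  exact h

theorem form_self (T : TensorSpace V m) :
    form T T = ∑ p, (auxBasis V m).repr T p ^ 2 := by
  have hb : ∀ p q, form (auxBasis V m p) (auxBasis V m q) = if p = q then (1 : ℝ) else 0 := by
    intro p q
    rw [auxBasis_apply, auxBasis_apply, form_decomposable]
    simp [OrthonormalBasis.inner_eq_ite, Fintype.prod_ite_zero, ← funext_iff]
  have hT := (auxBasis V m).sum_repr T
  calc form T T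
      = form (∑ p, (auxBasis V m).repr T p • auxBasis V m p)
          (∑ q, (auxBasis V m).repr T q • auxBasis V m q) := by rw [hT]
    _ = ∑ p, (auxBasis V m).repr T p ^ 2 := by
      simp only [map_sum, map_smul, LinearMap.sum_apply, LinearMap.smul_apply, hb]
      simp [sq]

/-- The Euclidean structure of `V^{⊗m}`. -/
@[reducible]
def core : InnerProductSpace.Core ℝ (TensorSpace V m) where
  inner S T := form S T
  conj_inner_symm S T := by simpa using form_symm T S
  re_inner_nonneg T := by
    have h : 0 ≤ form T T := by
      rw [form_self]
      exact Finset.sum_nonneg fun _ _ => sq_nonneg _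
    simpa using h
  add_left S T U := by simp
  smul_left S T r := by simp
  definite T h := by
    rw [form_self, Finset.sum_eq_zero_iff_of_nonneg fun _ _ => sq_nonneg _] at h
    refine (auxBasis V m).ext_elem fun p => ?_
    simpa using h p (Finset.mem_univ p)

instance : NormedAddCommGroup (TensorSpace V m) :=
  (core (V := V) (m := m)).toNormedAddCommGroup

instance : InnerProductSpace ℝ (TensorSpace V m) :=
  InnerProductSpace.ofCore (core (V := V) (m := m)).toCore

instance : FiniteDimensional ℝ (TensorSpace V m) :=
  (auxBasis V m).finiteDimensional_of_finite

theorem inner_decomposable (x y : Fin m → V) :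
    inner ℝ (decomposable x) (decomposable y) = ∏ i, inner ℝ (x i) (y i) :=
  form_decomposable x y

end TensorSpace

/-- The space `ℐ_m` of `O(V)`-invariant tensors in `V^{⊗m}`. -/
def invariantTensors (V : Type*) [NormedAddCommGroup V] [InnerProductSpace ℝ V]
    [FiniteDimensional ℝ V] (m : ℕ) : Submodule ℝ (TensorSpace V m) where
  carrier := {T | ∀ g : V ≃ₗᵢ[ℝ] V, TensorSpace.act g T = T}
  add_mem' {S T} hS hT g := by rw [map_add, hS g, hT g]
  zero_mem' g := map_zero _
  smul_mem' c T hT g := by rw [map_smul, hT g]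

/-- The tensor power `x^{⊗m} = x ⊗ ⋯ ⊗ x`. -/
def tensorPow {V : Type*} [NormedAddCommGroup V] [InnerProductSpace ℝ V] (m : ℕ) (x : V) :
    TensorSpace V m :=
  TensorSpace.decomposable fun _ => x

/-- The Veronese surface `{x^{⊗m} : ‖x‖ = 1}`. -/
def veroneseSurface (V : Type*) [NormedAddCommGroup V] [InnerProductSpace ℝ V] (m : ℕ) :
    Set (TensorSpace V m) :=
  tensorPow m '' Metric.sphere (0 : V) 1

/-- Pairings of the index set `{1, …, m}`: the partitions all of whose parts have two elements. -/
abbrev Pairing (m : ℕ) : Type :=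
  {P : Finpartition (Finset.univ : Finset (Fin m)) // ∀ J ∈ P.parts, J.card = 2}

/-- The standard invariant `I(𝒫) = ∑_{i₁,…,i_k} e_{i₁}(J₁) ⊗ ⋯ ⊗ e_{i_k}(J_k)` of the pairing
`𝒫 = {J₁, …, J_k}`. The sum runs over all assignments of an index `i J` to every part `J` of `𝒫`,
and the summand has the vector `e_{i J}` at all positions in `J`. -/
def standardInvariant {V : Type*} [NormedAddCommGroup V] [InnerProductSpace ℝ V] {n m : ℕ}
    (e : OrthonormalBasis (Fin n) ℝ V) (P : Pairing m) : TensorSpace V m :=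
  ∑ i : P.1.parts → Fin n, TensorSpace.decomposable fun j : Fin m =>
    e (i ⟨P.1.part j, P.1.part_mem.2 (Finset.mem_univ j)⟩)

/-- The average `A_m` of the standard invariants. -/
def averageInvariant {V : Type*} [NormedAddCommGroup V] [InnerProductSpace ℝ V] {n : ℕ}
    (e : OrthonormalBasis (Fin n) ℝ V) (m : ℕ) : TensorSpace V m :=
  (Fintype.card (Pairing m) : ℝ)⁻¹ • ∑ P : Pairing m, standardInvariant e P

/-- The Gram matrix `𝒢` of the standard invariants, indexed by the pairings. -/
def gramMatrix {V : Type*} [NormedAddCommGroup V] [InnerProductSpace ℝ V] [FiniteDimensional ℝ V]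
    {n : ℕ} (e : OrthonormalBasis (Fin n) ℝ V) (m : ℕ) : Matrix (Pairing m) (Pairing m) ℝ :=
  Matrix.gram ℝ fun P : Pairing m => standardInvariant e P

/-- The average of the entries of a square matrix. -/
def averageEntry {ι : Type*} [Fintype ι] (M : Matrix ι ι ℝ) : ℝ :=
  (∑ i, ∑ j, M i j) / (Fintype.card ι : ℝ) ^ 2

/-- `P(n,k) = n (n+2) ⋯ (n+2k-2)`. -/
def stepProduct (n k : ℕ) : ℕ :=
  ∏ j ∈ Finset.range k, (n + 2 * j)

/-- `μ_{k,n} = (2k-1)!! / P(n,k)`; for `k = 0` the double factorial `(-1)!!` is `1`, which is also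
the value of `Nat.doubleFactorial` at the truncated difference. -/
def mu (k n : ℕ) : ℝ :=
  (Nat.doubleFactorial (2 * k - 1) : ℝ) / (stepProduct n k : ℝ)

/-- `σ` is the law of an `O(V)`-invariant random unit vector: a Borel probability measure that is
concentrated on the unit sphere of `V` and invariant under the orthogonal group of `V`. -/
structure IsInvariantUnitLaw {V : Type*} [NormedAddCommGroup V] [InnerProductSpace ℝ V]
    [MeasurableSpace V] (σ : Measure V) : Prop where
  isProbabilityMeasure : IsProbabilityMeasure σ
  norm_eq_one : ∀ᵐ x ∂σ, ‖x‖ = 1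
  map_eq : ∀ g : V ≃ₗᵢ[ℝ] V, σ.map g = σ

/-- The uniform distribution on the unit sphere of `V` (normalized surface measure), as a measure
on `V`. -/
def uniformOnSphere (V : Type*) [NormedAddCommGroup V] [InnerProductSpace ℝ V]
    [FiniteDimensional ℝ V] [MeasurableSpace V] [BorelSpace V] : Measure V :=
  ((volume : Measure V).toSphere Set.univ)⁻¹ • (volume : Measure V).toSphere.map Subtype.val

end

/-! Let `x` have an invariant law and put `E = ∫ x^{⊗m}`. Then `E` is an invariant tensor. For
invariant `T`, `⟨x^{⊗m}, T⟩` is constant on the sphere because `O(V)` acts transitively there. Hence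
the projection of every unit power `u^{⊗m}` onto the invariants is `E` (`starProjection_tensorPow`).
That the `I(𝒫)` span the invariants is never needed.

To identify `E`, note that `E` and `∑ I(𝒫)` are both symmetric, so by polarization it suffices to
pair them with `y^{⊗2k}`. Each `I(𝒫)` gives `‖y‖^{2k}`, and there are `(2k-1)!!` pairings. `E` gives
`‖y‖^{2k}` times the moment of a coordinate, which is `(2k-1)!!/P(n,k)`. So `E = (1/P(n,k)) ∑ I(𝒫)`
(`integral_tensorPow`). Pairing this identity with one `I(𝒫)` gives the row sums of the Gram matrix.
-/

/-! ### Pairings as fixed-point-free involutions, and their number -/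

namespace Pairing

variable {m : ℕ}

theorem mem_part_self (P : Pairing m) (j : Fin m) : j ∈ P.1.part j :=
  P.1.mem_part_self.2 (Finset.mem_univ j)

theorem exists_part_eq (P : Pairing m) (j : Fin m) : ∃ l, l ≠ j ∧ P.1.part j = {j, l} := by
  obtain ⟨a, b, hab, h⟩ := Finset.card_eq_two.1 (P.2 _ (P.1.part_mem.2 (Finset.mem_univ j)))
  have hj := P.mem_part_self j
  rw [h] at hj ⊢
  rcases Finset.mem_insert.1 hj with rfl | hj
  · exact ⟨b, hab.symm, rfl⟩
  · obtain rfl := Finset.mem_singleton.1 hj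
    exact ⟨a, hab, Finset.pair_comm _ _⟩

/-- The element that a pairing matches with a given element. -/
noncomputable def partner (P : Pairing m) (j : Fin m) : Fin m :=
  (P.exists_part_eq j).choose

theorem partner_ne (P : Pairing m) (j : Fin m) : P.partner j ≠ j :=
  (P.exists_part_eq j).choose_spec.1

theorem part_eq (P : Pairing m) (j : Fin m) : P.1.part j = {j, P.partner j} :=
  (P.exists_part_eq j).choose_spec.2

theorem partner_involutive (P : Pairing m) : Function.Involutive P.partner := by
  intro j
  have h1 : P.partner j ∈ P.1.part j := by simp [part_eq]
  have h2 : P.1.part (P.partner j) = P.1.part j :=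
    P.1.part_eq_of_mem (P.1.part_mem.2 (Finset.mem_univ j)) h1
  have h3 := P.mem_part_self j
  rw [← h2, part_eq] at h3
  rcases Finset.mem_insert.1 h3 with h | h
  · exact absurd h.symm (P.partner_ne j)
  · exact (Finset.mem_singleton.1 h).symm

theorem ext_part {P Q : Pairing m} (h : ∀ j, P.1.part j = Q.1.part j) : P = Q := by
  have key : ∀ R S : Pairing m, (∀ j, R.1.part j = S.1.part j) → R.1.parts ⊆ S.1.parts := by
    intro R S h J hJ
    obtain ⟨j, hj⟩ := R.1.nonempty_of_mem_parts hJ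
    rw [← R.1.part_eq_of_mem hJ hj, h]
    exact S.1.part_mem.2 (Finset.mem_univ j)
  exact Subtype.ext (Finpartition.ext (Finset.Subset.antisymm (key P Q h)
    (key Q P fun j => (h j).symm)))

theorem partner_injective : Function.Injective (partner : Pairing m → Fin m → Fin m) := by
  intro P Q h
  exact ext_part fun j => by rw [part_eq, part_eq, h]

theorem exists_partner_eq {f : Fin m → Fin m} (hf : Function.Involutive f) (hne : ∀ j, f j ≠ j) :
    ∃ P : Pairing m, P.partner = f := by
  classical
  let s : Setoid (Fin m) :=
    { r := fun i j => j = i ∨ j = f i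
      iseqv := by
        refine ⟨fun i => Or.inl rfl, ?_, ?_⟩
        · rintro i j (rfl | rfl)
          · exact Or.inl rfl
          · exact Or.inr (hf i).symm
        · rintro i j l (rfl | rfl) (rfl | rfl)
          · exact Or.inl rfl
          · exact Or.inr rfl
          · exact Or.inr rfl
          · exact Or.inl (hf i) }
  have hpart : ∀ j, (Finpartition.ofSetoid s).part j = {j, f j} := by
    intro j
    ext l
    rw [Finpartition.mem_part_ofSetoid_iff_rel, Finset.mem_insert, Finset.mem_singleton]
    exact Iff.rfl
  have hcard : ∀ J ∈ (Finpartition.ofSetoid s).parts, J.card = 2 := by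
    intro J hJ
    obtain ⟨j, hj⟩ := (Finpartition.ofSetoid s).nonempty_of_mem_parts hJ
    rw [← (Finpartition.ofSetoid s).part_eq_of_mem hJ hj, hpart]
    exact Finset.card_pair (hne j).symm
  refine ⟨⟨Finpartition.ofSetoid s, hcard⟩, funext fun j => ?_⟩
  have h1 := part_eq ⟨Finpartition.ofSetoid s, hcard⟩ j
  have h2 : f j ∈ ({j, f j} : Finset (Fin m)) := by simp
  rw [← hpart, h1] at h2
  rcases Finset.mem_insert.1 h2 with h | h
  · exact absurd h (hne j)
  · exact (Finset.mem_singleton.1 h).symm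

open Equiv.Perm in
theorem cycleType_eq_replicate_two_iff {k : ℕ} (g : Equiv.Perm (Fin (2 * k))) :
    g.cycleType = Multiset.replicate k 2 ↔ Function.Involutive g ∧ ∀ j, g j ≠ j := by
  have hsum := sum_cycleType g
  constructor
  · intro h
    rw [h] at hsum
    have hs : g.support = Finset.univ := by
      rw [← Finset.card_eq_iff_eq_univ, ← hsum]
      simp [mul_comm]
    have ho : g ^ 2 = 1 := by
      rw [← orderOf_dvd_iff_pow_eq_one, ← lcm_cycleType, h, Multiset.lcm_dvd]
      intro b hb
      rw [Multiset.eq_of_mem_replicate hb]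
    refine ⟨fun j => ?_, fun j => ?_⟩
    · have := congrArg (fun u => u j) ho
      simpa [sq] using this
    · rw [← mem_support, hs]
      exact Finset.mem_univ j
  · rintro ⟨hi, hne⟩
    have hs : g.support = Finset.univ := by
      ext j
      simp [hne j]
    have h2 : ∀ b ∈ g.cycleType, b = 2 := by
      intro b hb
      have ho : g ^ 2 = 1 := by
        ext j
        simp [sq, hi j]
      exact le_antisymm (Nat.le_of_dvd two_pos
        ((dvd_of_mem_cycleType hb).trans (orderOf_dvd_of_pow_eq_one ho))) (two_le_of_mem_cycleType hb)
    have hr := Multiset.eq_replicate_card.2 h2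
    rw [hr, hs] at hsum
    have : Multiset.card g.cycleType = k := by
      simp at hsum
      omega
    rw [hr, this]

/-- `partner` identifies pairings with permutations of cycle type `2^k`. Their number is `(2k)!/(2^k
k!)`, and `(2k)! = (2k-1)!! (2k)!!` with `(2k)!! = 2^k k!`. -/
theorem card_eq (k : ℕ) : Fintype.card (Pairing (2 * k)) = Nat.doubleFactorial (2 * k - 1) := by
  classical
  have hcard : Fintype.card (Pairing (2 * k)) =
      ({g | g.cycleType = Multiset.replicate k 2} : Finset (Equiv.Perm (Fin (2 * k)))).card := by
    rw [← Finset.card_univ]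
    refine Finset.card_bij (fun P _ => P.partner_involutive.toPerm) ?_ ?_ ?_
    · intro P _
      rw [Finset.mem_filter_univ, cycleType_eq_replicate_two_iff]
      exact ⟨P.partner_involutive, P.partner_ne⟩
    · intro P _ Q _ h
      exact partner_injective (congrArg DFunLike.coe h)
    · intro g hg
      rw [Finset.mem_filter_univ, cycleType_eq_replicate_two_iff] at hg
      obtain ⟨P, hP⟩ := exists_partner_eq hg.1 hg.2
      exact ⟨P, Finset.mem_univ _, Equiv.ext fun j => congrFun hP j⟩
  have h := Equiv.Perm.card_of_cycleType_mul_eq (Fin (2 * k)) (Multiset.replicate k 2)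
  rw [← hcard, if_pos ⟨by simp [mul_comm], fun a ha => (Multiset.eq_of_mem_replicate ha).ge⟩] at h
  -- For `k = 0` the cycle type is empty; otherwise 2 is its only distinct part.
  rcases k with _ | k
  · simpa using h
  · have h2 : (2 * (k + 1)).factorial =
        (2 * (k + 1) - 1).doubleFactorial * (2 ^ (k + 1) * (k + 1).factorial) := by
      rw [← Nat.doubleFactorial_two_mul, show 2 * (k + 1) = 2 * k + 1 + 1 by ring,
        Nat.factorial_eq_mul_doubleFactorial, mul_comm]
      simp
    rw [Fintype.card_fin, h2] at h
    refine Nat.eq_of_mul_eq_mul_right (m := 2 ^ (k + 1) * (k + 1).factorial) (by positivity) ?_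
    rw [← h]
    have ht : (Multiset.replicate (k + 1) 2).toFinset = {2} := by
      rw [← Multiset.nsmul_singleton, Multiset.toFinset_nsmul _ _ k.succ_ne_zero,
        Multiset.toFinset_singleton]
    rw [ht, Finset.prod_singleton, Multiset.count_replicate_self, Multiset.sum_replicate,
      Multiset.prod_replicate, smul_eq_mul, mul_comm (k + 1) 2, Nat.sub_self, Nat.factorial_zero,
      one_mul]

/-- The order automorphism of the finite sets of indices induced by a permutation. -/
def imageIso (g : Equiv.Perm (Fin m)) : Finset (Fin m) ≃o Finset (Fin m) where
  toEquiv := Equiv.finsetCongr g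
  map_rel_iff' := by simp

/-- The image of a pairing under a permutation of the indices. -/
def permute (g : Equiv.Perm (Fin m)) (P : Pairing m) : Pairing m :=
  ⟨(P.1.map (imageIso g)).copy (by simp [imageIso]), by
    intro J hJ
    simp only [Finpartition.copy_parts, Finpartition.parts_map, Finset.mem_map] at hJ
    obtain ⟨K, hK, rfl⟩ := hJ
    simpa [imageIso] using P.2 K hK⟩

theorem parts_permute (g : Equiv.Perm (Fin m)) (P : Pairing m) :
    (P.permute g).1.parts = P.1.parts.map (imageIso g).toEquiv.toEmbedding := by
  simp only [permute, Finpartition.copy_parts, Finpartition.parts_map]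
  rfl

theorem permute_bijective (g : Equiv.Perm (Fin m)) :
    Function.Bijective (permute g : Pairing m → Pairing m) := by
  rw [← Finite.injective_iff_bijective]
  intro P Q h
  have h1 : (P.permute g).1.parts = (Q.permute g).1.parts := by rw [h]
  rw [parts_permute, parts_permute] at h1
  exact Subtype.ext (Finpartition.ext (Finset.map_injective _ h1))

end Pairing

/-! ### Invariant laws on the sphere and their moments -/

theorem exists_linearIsometryEquiv_apply_eq {V : Type*} [NormedAddCommGroup V]
    [InnerProductSpace ℝ V] {v w : V} (h : ‖v‖ = ‖w‖) : ∃ g : V ≃ₗᵢ[ℝ] V, g v = w :=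
  ⟨(ℝ ∙ (v - w))ᗮ.reflection, Submodule.reflection_sub h⟩

namespace IsInvariantUnitLaw

variable {V : Type*} [NormedAddCommGroup V] [InnerProductSpace ℝ V]
  [MeasurableSpace V] [BorelSpace V] {σ : Measure V}

/-- An isometry is a measurable embedding, so the change of variables needs no measurability of `f`.
-/
theorem integral_comp (hσ : IsInvariantUnitLaw σ) {E : Type*} [NormedAddCommGroup E]
    [NormedSpace ℝ E] (g : V ≃ₗᵢ[ℝ] V) (f : V → E) : ∫ x, f (g x) ∂σ = ∫ x, f x ∂σ := by
  have h := g.toHomeomorph.measurableEmbedding.integral_map (μ := σ) f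
  have h2 : σ.map g.toHomeomorph = σ := hσ.map_eq g
  rw [h2] at h
  exact h.symm

/-- The moments of linear functionals depend only on the norm of the functional. -/
theorem integral_inner_pow (hσ : IsInvariantUnitLaw σ) {u : V} (hu : ‖u‖ = 1) (y : V) (N : ℕ) :
    ∫ x, inner ℝ x y ^ N ∂σ = ‖y‖ ^ N * ∫ x, inner ℝ x u ^ N ∂σ := by
  obtain ⟨g, hg⟩ := exists_linearIsometryEquiv_apply_eq (v := ‖y‖ • u) (w := y)
    (by simp [norm_smul, hu])
  rw [← hσ.integral_comp g, ← integral_const_mul]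
  refine integral_congr_ae (.of_forall fun x => ?_)
  have : inner ℝ (g x) y = ‖y‖ * inner ℝ x u := by
    conv_lhs => rw [← hg]
    rw [g.inner_map_map, real_inner_smul_right]
  simp only [this, mul_pow]

variable [FiniteDimensional ℝ V]

theorem integrable (hσ : IsInvariantUnitLaw σ) {E : Type*} [NormedAddCommGroup E] {f : V → E}
    (hf : Continuous f) : Integrable f σ := by
  have := hσ.isProbabilityMeasure
  have := FiniteDimensional.proper ℝ V
  obtain ⟨C, hC⟩ := (isCompact_sphere (0 : V) 1).exists_bound_of_continuousOn hf.continuousOn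
  refine Integrable.of_bound hf.aestronglyMeasurable C ?_
  filter_upwards [hσ.norm_eq_one] with x hx
  exact hC x (by simpa using hx)

/-- Since `‖tv + u‖² = 1 + t²`, the moment of order `2k+2` of `⟨x, tv + u⟩` is `(1 + t²)^{k+1}`
times that of `⟨x, u⟩`. Compare coefficients of `t²`, using `(2k+2 choose 2) = (k+1)(2k+1)`. -/
theorem integral_inner_pow_mul_inner_sq (hσ : IsInvariantUnitLaw σ) {u v : V} (hu : ‖u‖ = 1)
    (hv : ‖v‖ = 1) (huv : inner ℝ u v = 0) (k : ℕ) :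
    (2 * k + 1) * ∫ x, inner ℝ x u ^ (2 * k) * inner ℝ x v ^ 2 ∂σ =
      ∫ x, inner ℝ x u ^ (2 * (k + 1)) ∂σ := by
  let c : ℕ → ℝ := fun j => ∫ x, inner ℝ x v ^ j * inner ℝ x u ^ (2 * (k + 1) - j) ∂σ
  let Q : Polynomial ℝ := ∑ j ∈ Finset.range (2 * (k + 1) + 1),
    Polynomial.C (c j * (Nat.choose (2 * (k + 1)) j : ℝ)) * Polynomial.X ^ j
  -- `expand ℝ 2` substitutes `X²` for `X`, which gives `(1 + X²)^{k+1}`.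
  have hQ : Q = Polynomial.C (∫ x, inner ℝ x u ^ (2 * (k + 1)) ∂σ) *
      Polynomial.expand ℝ 2 ((1 + Polynomial.X) ^ (k + 1)) := by
    refine Polynomial.funext fun t => ?_
    have h := hσ.integral_inner_pow hu (t • v + u) (2 * (k + 1))
    have hn : ‖t • v + u‖ ^ (2 * (k + 1)) = (1 + t ^ 2) ^ (k + 1) := by
      rw [pow_mul, norm_add_sq_real, real_inner_smul_left, real_inner_comm, huv]
      simp [norm_smul, hu, hv, add_comm]
    have hl : ∫ x, inner ℝ x (t • v + u) ^ (2 * (k + 1)) ∂σ = Q.eval t := by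
      simp only [inner_add_right, real_inner_smul_right, add_pow, mul_pow]
      rw [integral_finsetSum _ fun j _ => hσ.integrable (by fun_prop)]
      simp only [Q, Polynomial.eval_finsetSum, c]
      refine Finset.sum_congr rfl fun j _ => ?_
      simp only [Polynomial.eval_mul, Polynomial.eval_C, Polynomial.eval_pow, Polynomial.eval_X,
        mul_assoc, integral_const_mul]
      rw [mul_comm]
      simp only [← mul_assoc, integral_mul_const]
    rw [← hl, h, hn]
    simp [mul_comm]
  have h2 := congrArg (fun p : Polynomial ℝ => p.coeff 2) hQ
  have hl : Q.coeff 2 = c 2 * (Nat.choose (2 * (k + 1)) 2 : ℝ) := by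
    simp only [Q, Polynomial.finsetSum_coeff, Polynomial.coeff_C_mul, Polynomial.coeff_X_pow,
      mul_ite, mul_one, mul_zero]
    rw [Finset.sum_ite_eq, if_pos (Finset.mem_range.2 (by omega))]
  have hr : (Polynomial.expand ℝ 2 ((1 + Polynomial.X) ^ (k + 1))).coeff 2 = (k + 1 : ℝ) := by
    have := Polynomial.coeff_expand_mul (R := ℝ) two_pos ((1 + Polynomial.X) ^ (k + 1)) 1
    simpa [Polynomial.coeff_one_add_X_pow] using this
  simp only [hl, Polynomial.coeff_C_mul, hr] at h2
  have hc : c 2 = ∫ x, inner ℝ x u ^ (2 * k) * inner ℝ x v ^ 2 ∂σ := by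
    simp only [c, show 2 * (k + 1) - 2 = 2 * k by omega]
    exact integral_congr_ae (.of_forall fun x => mul_comm _ _)
  have hch : (Nat.choose (2 * (k + 1)) 2 : ℝ) = (k + 1) * (2 * k + 1) := by
    rw [Nat.cast_choose_two]
    push_cast
    ring
  rw [hc, hch] at h2
  have hk : (k + 1 : ℝ) ≠ 0 := by positivity
  apply mul_left_cancel₀ hk
  linarith

/-- Insert `1 = ∑ⱼ ⟨x, eⱼ⟩²` into the moment `M_k`. The term `j = i` is `M_{k+1}` and each of the
other `n-1` is `M_{k+1}/(2k+1)`, so `(2k+1) M_k = (n+2k) M_{k+1}`. -/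
theorem stepProduct_mul_integral_inner_pow {n : ℕ} (hσ : IsInvariantUnitLaw σ)
    (e : OrthonormalBasis (Fin n) ℝ V) (i : Fin n) (k : ℕ) :
    stepProduct n k * ∫ x, inner ℝ x (e i) ^ (2 * k) ∂σ = (Nat.doubleFactorial (2 * k - 1) : ℝ) := by
  have := hσ.isProbabilityMeasure
  induction k with
  | zero => simp [stepProduct]
  | succ k ih =>
    have hs : ∫ x, inner ℝ x (e i) ^ (2 * k) ∂σ =
        ∑ j, ∫ x, inner ℝ x (e i) ^ (2 * k) * inner ℝ x (e j) ^ 2 ∂σ := by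
      rw [← integral_finsetSum _ fun j _ => hσ.integrable (by fun_prop)]
      refine integral_congr_ae ?_
      filter_upwards [hσ.norm_eq_one] with x hx
      simp only [← Finset.mul_sum]
      have := e.sum_sq_inner_left x
      rw [this, hx]
      simp
    have hne : ∀ j ∈ Finset.univ.erase i, (2 * k + 1) *
        ∫ x, inner ℝ x (e i) ^ (2 * k) * inner ℝ x (e j) ^ 2 ∂σ =
          ∫ x, inner ℝ x (e i) ^ (2 * (k + 1)) ∂σ := fun j hj =>
      hσ.integral_inner_pow_mul_inner_sq (e.norm_eq_one i) (e.norm_eq_one j)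
        (e.inner_eq_zero (Finset.ne_of_mem_erase hj).symm) k
    have hrec : (2 * k + 1) * ∫ x, inner ℝ x (e i) ^ (2 * k) ∂σ =
        (n + 2 * k) * ∫ x, inner ℝ x (e i) ^ (2 * (k + 1)) ∂σ := by
      rw [hs, ← Finset.add_sum_erase _ _ (Finset.mem_univ i), mul_add, Finset.mul_sum,
        Finset.sum_congr rfl hne, Finset.sum_const, Finset.card_erase_of_mem (Finset.mem_univ i),
        Finset.card_univ, Fintype.card_fin, nsmul_eq_mul,
        Nat.cast_sub (Nat.one_le_iff_ne_zero.2 (Fin.pos i).ne')]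
      simp only [← pow_add, show 2 * k + 2 = 2 * (k + 1) by ring]
      push_cast
      ring
    have hd : (2 * (k + 1) - 1).doubleFactorial = (2 * k + 1) * (2 * k - 1).doubleFactorial := by
      rw [show 2 * (k + 1) - 1 = 2 * k + 1 by omega, Nat.doubleFactorial_add_one]
    rw [stepProduct, Finset.prod_range_succ, ← stepProduct, hd]
    push_cast
    rw [← ih, mul_assoc, ← hrec]
    ring

end IsInvariantUnitLaw

/-! ### Invariance of the surface measure -/

section UniformOnSphere

variable (V : Type*) [NormedAddCommGroup V] [InnerProductSpace ℝ V]
  [FiniteDimensional ℝ V] [MeasurableSpace V] [BorelSpace V]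

open scoped Pointwise in
-- The surface measure of `B` is a constant times the volume of the cone `(0,1) • B`; `g` commutes
-- with forming cones and preserves volume.
theorem map_toSphere_val_linearIsometryEquiv (g : V ≃ₗᵢ[ℝ] V) :
    ((volume : Measure V).toSphere.map Subtype.val).map g =
      (volume : Measure V).toSphere.map Subtype.val := by
  have hg : Measurable g := g.continuous.measurable
  ext B hB
  rw [Measure.map_apply hg hB, Measure.map_apply measurable_subtype_coe (hg hB),
    Measure.map_apply measurable_subtype_coe hB,
    Measure.toSphere_apply' _ (measurable_subtype_coe (hg hB)),
    Measure.toSphere_apply' _ (measurable_subtype_coe hB)]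
  congr 1
  have hset : Set.Ioo (0 : ℝ) 1 • (Subtype.val '' (Subtype.val ⁻¹' (g ⁻¹' B) : Set (Metric.sphere (0 : V) 1))) =
      g ⁻¹' (Set.Ioo (0 : ℝ) 1 • (Subtype.val '' (Subtype.val ⁻¹' B : Set (Metric.sphere (0 : V) 1)))) := by
    ext x
    simp only [Set.mem_smul, Set.mem_image, Set.mem_preimage, Subtype.exists, mem_sphere_zero_iff_norm]
    constructor
    · rintro ⟨r, hr, y, ⟨a, ha, hay, rfl⟩, rfl⟩
      exact ⟨r, hr, g a, ⟨g a, by simpa using ha, hay, rfl⟩, by simp⟩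
    · rintro ⟨r, hr, y, ⟨a, ha, hay, rfl⟩, h⟩
      exact ⟨r, hr, g.symm a, ⟨g.symm a, by simpa using ha, by simpa using hay, rfl⟩,
        g.injective (by simpa using h)⟩
  rw [hset]
  exact g.measurePreserving.measure_preimage_equiv (f := g.toMeasurableEquiv) _

theorem isInvariantUnitLaw_uniformOnSphere [Nontrivial V] :
    IsInvariantUnitLaw (uniformOnSphere V) where
  isProbabilityMeasure := by
    refine ⟨?_⟩
    rw [uniformOnSphere, Measure.smul_apply, Measure.map_apply measurable_subtype_coe .univ,
      Set.preimage_univ, smul_eq_mul]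
    refine ENNReal.inv_mul_cancel ?_ (measure_ne_top _ _)
    rw [Ne, Measure.measure_univ_eq_zero]
    exact Measure.toSphere_ne_zero _
  norm_eq_one := by
    refine Measure.ae_smul_measure ?_ _
    rw [ae_map_iff measurable_subtype_coe.aemeasurable
      (measurableSet_eq_fun measurable_norm measurable_const)]
    exact .of_forall fun x => mem_sphere_zero_iff_norm.1 x.2
  map_eq g := by
    rw [uniformOnSphere, Measure.map_smul, map_toSphere_val_linearIsometryEquiv]

end UniformOnSphere

/-! ### Continuity of tensor powers, and polarization -/

namespace TensorSpace

variable {V : Type*} [NormedAddCommGroup V] [InnerProductSpace ℝ V] {m : ℕ}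

theorem act_decomposable (g : V ≃ₗᵢ[ℝ] V) (x : Fin m → V) :
    act g (decomposable x) = decomposable fun i => g (x i) :=
  PiTensorProduct.map_tprod _ _

theorem act_tensorPow (g : V ≃ₗᵢ[ℝ] V) (x : V) : act g (tensorPow m x) = tensorPow m (g x) :=
  act_decomposable g _

variable [FiniteDimensional ℝ V]

theorem norm_decomposable (x : Fin m → V) : ‖decomposable x‖ = ∏ i, ‖x i‖ := by
  have h : ‖decomposable x‖ ^ 2 = (∏ i, ‖x i‖) ^ 2 := by
    rw [← real_inner_self_eq_norm_sq, inner_decomposable, ← Finset.prod_pow]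
    simp only [real_inner_self_eq_norm_sq]
  exact (pow_left_inj₀ (norm_nonneg _) (Finset.prod_nonneg fun _ _ => norm_nonneg _)
    two_ne_zero).1 h

/-- The decomposable tensor as a continuous multilinear function of its factors. -/
noncomputable def decomposableCMM (V : Type*) [NormedAddCommGroup V] [InnerProductSpace ℝ V]
    [FiniteDimensional ℝ V] (m : ℕ) :
    ContinuousMultilinearMap ℝ (fun _ : Fin m => V) (TensorSpace V m) :=
  MultilinearMap.mkContinuous
    { toFun := decomposable
      map_update_add' := (PiTensorProduct.tprod ℝ (s := fun _ : Fin m => V)).map_update_add'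
      map_update_smul' := (PiTensorProduct.tprod ℝ (s := fun _ : Fin m => V)).map_update_smul' }
    1 fun x => (norm_decomposable x).le.trans_eq (one_mul _).symm

theorem continuous_tensorPow : Continuous (tensorPow m : V → TensorSpace V m) :=
  (decomposableCMM V m).cont.comp (continuous_pi fun _ => continuous_id)

theorem inner_tensorPow (x y : V) : inner ℝ (tensorPow m x) (tensorPow m y) = inner ℝ x y ^ m := by
  simp [tensorPow, inner_decomposable]

theorem eq_zero_of_inner_decomposable {T : TensorSpace V m}
    (h : ∀ x, inner ℝ T (decomposable x) = 0) : T = 0 := by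
  have h0 : form T = 0 := hom_ext h
  have h1 : inner ℝ T T = form T T := rfl
  rw [← inner_self_eq_zero (𝕜 := ℝ), h1, h0, LinearMap.zero_apply]

/-- Polarization: a symmetric tensor is determined by its inner products with the powers. -/
theorem eq_zero_of_inner_tensorPow {T : TensorSpace V m}
    (hsymm : ∀ (x : Fin m → V) (g : Equiv.Perm (Fin m)),
      inner ℝ T (decomposable fun i => x (g i)) = inner ℝ T (decomposable x))
    (hpow : ∀ y : V, inner ℝ T (tensorPow m y) = 0) : T = 0 := by
  refine eq_zero_of_inner_decomposable fun x => ?_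
  let f := (innerSL ℝ T).compContinuousMultilinearMap (decomposableCMM V m)
  -- The `m`-th derivative of `y ↦ f (y, …, y)` is the sum of `f (x ∘ g)` over all permutations `g`.
  -- By symmetry this is `m! ⟨T, x₁ ⊗ ⋯ ⊗ x_m⟩`.
  have h := f.iteratedFDeriv_comp_diagonal 0 x
  have h0 : (fun y : V => f fun _ => y) = 0 := funext hpow
  have h1 : ∀ g : Equiv.Perm (Fin m), f (fun i => x (g i)) = inner ℝ T (decomposable x) :=
    fun g => hsymm x g
  rw [h0] at h
  simp only [h1, Finset.sum_const, nsmul_eq_mul] at h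
  have h2 : iteratedFDeriv ℝ m (0 : V → ℝ) 0 = 0 := by
    simp
  rw [h2] at h
  have h3 : ((Finset.univ : Finset (Equiv.Perm (Fin m))).card : ℝ) ≠ 0 := by
    simp [Finset.card_univ, Fintype.card_perm, Nat.factorial_ne_zero]
  exact (mul_eq_zero.1 h.symm).resolve_left h3

end TensorSpace

open TensorSpace

theorem stepProduct_pos {n : ℕ} (hn : 0 < n) (k : ℕ) : 0 < stepProduct n k :=
  Finset.prod_pos fun _ _ => by omega

/-! ### Inner products with the standard invariants -/

section StandardInvariant

variable {V : Type*} [NormedAddCommGroup V] [InnerProductSpace ℝ V] [FiniteDimensional ℝ V]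
  {n m : ℕ} (e : OrthonormalBasis (Fin n) ℝ V)

/-- Grouping the positions by parts makes each factor depend on the index of its own part only, so
the sum over all index assignments factorizes. -/
theorem inner_standardInvariant_decomposable (P : Pairing m) (y : Fin m → V) :
    inner ℝ (standardInvariant e P) (decomposable y) =
      ∏ J ∈ P.1.parts, ∑ a, ∏ j ∈ J, inner ℝ (e a) (y j) := by
  classical
  have hfib : ∀ i : P.1.parts → Fin n,
      ∏ j, inner ℝ (e (i ⟨P.1.part j, P.1.part_mem.2 (Finset.mem_univ j)⟩)) (y j) =
        ∏ J : P.1.parts, ∏ j ∈ J.1, inner ℝ (e (i J)) (y j) := by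
    intro i
    rw [← Finset.prod_fiberwise Finset.univ
      fun j => (⟨P.1.part j, P.1.part_mem.2 (Finset.mem_univ j)⟩ : P.1.parts)]
    refine Finset.prod_congr rfl fun J _ => ?_
    refine Finset.prod_congr ?_ fun j hj => ?_
    · ext j
      simp [Subtype.ext_iff, P.1.part_eq_iff_mem J.2]
    · rw [show (⟨P.1.part j, P.1.part_mem.2 (Finset.mem_univ j)⟩ : P.1.parts) = J from
        Subtype.ext ((P.1.part_eq_iff_mem J.2).2 hj)]
  rw [standardInvariant, sum_inner]
  simp only [inner_decomposable, hfib]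
  rw [← Finset.prod_coe_sort, Finset.prod_univ_sum, Fintype.piFinset_univ]

theorem Pairing.two_mul_card_parts (P : Pairing m) : 2 * P.1.parts.card = m := by
  have h := P.1.sum_card_parts
  rw [Finset.sum_congr rfl P.2] at h
  simpa [mul_comm] using h

theorem inner_standardInvariant_tensorPow {k : ℕ} (P : Pairing (2 * k)) (y : V) :
    inner ℝ (standardInvariant e P) (tensorPow (2 * k) y) = ‖y‖ ^ (2 * k) := by
  have hJ : ∀ J ∈ P.1.parts, ∑ a, ∏ j ∈ J, inner ℝ (e a) y = ‖y‖ ^ 2 := by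
    intro J hJ
    simp only [Finset.prod_const, P.2 J hJ]
    exact e.sum_sq_inner_right y
  have hk : P.1.parts.card = k := by
    have := P.two_mul_card_parts
    omega
  rw [tensorPow, inner_standardInvariant_decomposable, Finset.prod_congr rfl hJ,
    Finset.prod_const, hk, pow_mul]

/-- Permuting positions permutes the pairings: a single `I(𝒫)` need not be symmetric, but the sum
is. -/
theorem inner_sum_standardInvariant_perm (y : Fin m → V) (g : Equiv.Perm (Fin m)) :
    inner ℝ (∑ P : Pairing m, standardInvariant e P) (decomposable fun i => y (g i)) =
      inner ℝ (∑ P : Pairing m, standardInvariant e P) (decomposable y) := by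
  simp only [sum_inner, inner_standardInvariant_decomposable]
  conv_rhs => rw [← (Pairing.permute_bijective g).sum_comp]
  refine Finset.sum_congr rfl fun P _ => ?_
  rw [Pairing.parts_permute, Finset.prod_map]
  refine Finset.prod_congr rfl fun J _ => Finset.sum_congr rfl fun a _ => ?_
  exact (Finset.prod_map J g.toEmbedding fun j => inner ℝ (e a) (y j)).symm

end StandardInvariant

/-! ### The expectation of a random tensor power -/

namespace IsInvariantUnitLaw

variable {V : Type*} [NormedAddCommGroup V] [InnerProductSpace ℝ V]
  [FiniteDimensional ℝ V] [MeasurableSpace V] [BorelSpace V] {σ : Measure V}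

theorem inner_integral_tensorPow {m : ℕ} (hσ : IsInvariantUnitLaw σ) (T : TensorSpace V m) :
    inner ℝ (∫ x, tensorPow m x ∂σ) T = ∫ x, inner ℝ (tensorPow m x) T ∂σ := by
  rw [real_inner_comm, ← integral_inner (hσ.integrable continuous_tensorPow)]
  simp only [real_inner_comm]

theorem integral_tensorPow_mem_invariantTensors (hσ : IsInvariantUnitLaw σ) (m : ℕ) :
    ∫ x, tensorPow m x ∂σ ∈ invariantTensors V m := by
  intro g
  have h := (LinearMap.toContinuousLinearMap (act g : TensorSpace V m →ₗ[ℝ] _)).integral_comp_comm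
    (hσ.integrable (continuous_tensorPow (m := m)))
  refine h.symm.trans ?_
  simp only [LinearMap.coe_toContinuousLinearMap', act_tensorPow]
  exact hσ.integral_comp g _

theorem starProjection_tensorPow (hσ : IsInvariantUnitLaw σ) (m : ℕ) {u : V} (hu : ‖u‖ = 1) :
    (invariantTensors V m).starProjection (tensorPow m u) = ∫ x, tensorPow m x ∂σ := by
  have := hσ.isProbabilityMeasure
  refine Submodule.eq_starProjection_of_mem_of_inner_eq_zero
    (hσ.integral_tensorPow_mem_invariantTensors m) fun T hT => ?_
  -- Write `x = g u`; the action of `g` preserves the form and fixes `T`.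
  have hconst : ∀ᵐ x ∂σ, inner ℝ (tensorPow m x) T = inner ℝ (tensorPow m u) T := by
    filter_upwards [hσ.norm_eq_one] with x hx
    obtain ⟨g, rfl⟩ := exists_linearIsometryEquiv_apply_eq (hu.trans hx.symm)
    have hadj : ∀ S R : TensorSpace V m, inner ℝ (act g S) (act g R) = inner ℝ S R := by
      intro S R
      have : (form.compl₁₂ (act g) (act g) : TensorSpace V m →ₗ[ℝ] TensorSpace V m →ₗ[ℝ] ℝ) =
          form := by
        refine hom_ext fun x => hom_ext fun y => ?_
        simp [act_decomposable, form_decomposable]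
      exact congrArg (fun B => B S R) this
    rw [← act_tensorPow, ← hadj (tensorPow m u) T, hT g]
  rw [inner_sub_left, hσ.inner_integral_tensorPow, integral_congr_ae hconst]
  simp

theorem integral_tensorPow {n : ℕ} (hσ : IsInvariantUnitLaw σ) (hn : 0 < n)
    (e : OrthonormalBasis (Fin n) ℝ V) (k : ℕ) :
    ∫ x, tensorPow (2 * k) x ∂σ =
      (1 / (stepProduct n k : ℝ)) • ∑ P : Pairing (2 * k), standardInvariant e P := by
  rw [← sub_eq_zero]
  have hP : (stepProduct n k : ℝ) ≠ 0 :=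
    Nat.cast_ne_zero.2 (stepProduct_pos hn k).ne'
  refine eq_zero_of_inner_tensorPow (fun x g => ?_) fun y => ?_
  · rw [inner_sub_left, inner_sub_left, real_inner_smul_left, real_inner_smul_left,
      inner_sum_standardInvariant_perm, hσ.inner_integral_tensorPow, hσ.inner_integral_tensorPow]
    congr 1
    refine integral_congr_ae (.of_forall fun z => ?_)
    simp only [tensorPow, inner_decomposable]
    exact Equiv.prod_comp g fun i => inner ℝ z (x i)
  · have hm := hσ.stepProduct_mul_integral_inner_pow e ⟨0, hn⟩ k
    rw [inner_sub_left, real_inner_smul_left, hσ.inner_integral_tensorPow, sum_inner]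
    simp only [inner_tensorPow, inner_standardInvariant_tensorPow, Finset.sum_const, nsmul_eq_mul,
      Finset.card_univ, Pairing.card_eq]
    rw [hσ.integral_inner_pow (e.norm_eq_one ⟨0, hn⟩), ← hm]
    field_simp
    ring

end IsInvariantUnitLaw

/-! ### Gram matrix and conclusion -/

theorem mu_smul_averageInvariant {V : Type*} [NormedAddCommGroup V] [InnerProductSpace ℝ V]
    {n : ℕ} (e : OrthonormalBasis (Fin n) ℝ V) (k : ℕ) :
    mu k n • averageInvariant e (2 * k) =
      (1 / (stepProduct n k : ℝ)) • ∑ P : Pairing (2 * k), standardInvariant e P := by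
  have : (Nat.doubleFactorial (2 * k - 1) : ℝ) ≠ 0 :=
    Nat.cast_ne_zero.2 (Nat.doubleFactorial_pos _).ne'
  rw [averageInvariant, smul_smul, Pairing.card_eq, mu]
  congr 1
  field_simp

/-- On the unit sphere `⟨x^{⊗2k}, I(𝒫)⟩ = 1`, so the expectation pairs to 1 with `I(𝒫)`. By its
formula it also pairs to the row sum divided by `P(n,k)`. -/
theorem sum_gramMatrix_row {V : Type*} [NormedAddCommGroup V] [InnerProductSpace ℝ V]
    [FiniteDimensional ℝ V] {n : ℕ} (hn : 0 < n) (e : OrthonormalBasis (Fin n) ℝ V) (k : ℕ)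
    (P : Pairing (2 * k)) : ∑ Q, gramMatrix e (2 * k) P Q = (stepProduct n k : ℝ) := by
  borelize V
  have : Nontrivial V := ⟨e ⟨0, hn⟩, 0, e.toBasis.ne_zero _⟩
  have hσ := isInvariantUnitLaw_uniformOnSphere V
  have := hσ.isProbabilityMeasure
  have h : inner ℝ (∫ x, tensorPow (2 * k) x ∂(uniformOnSphere V)) (standardInvariant e P) = 1 := by
    rw [hσ.inner_integral_tensorPow]
    have : ∀ᵐ x ∂(uniformOnSphere V),
        inner ℝ (tensorPow (2 * k) x) (standardInvariant e P) = 1 := by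
      filter_upwards [hσ.norm_eq_one] with x hx
      rw [real_inner_comm, inner_standardInvariant_tensorPow, hx, one_pow]
    rw [integral_congr_ae this]
    simp
  have hP : (stepProduct n k : ℝ) ≠ 0 := Nat.cast_ne_zero.2 (stepProduct_pos hn k).ne'
  rw [hσ.integral_tensorPow hn e, real_inner_smul_left, real_inner_comm, inner_sum] at h
  simp only [gramMatrix, Matrix.gram_apply]
  field_simp at h
  exact h

theorem averageEntry_gramMatrix {V : Type*} [NormedAddCommGroup V] [InnerProductSpace ℝ V]
    [FiniteDimensional ℝ V] {n : ℕ} (hn : 0 < n) (e : OrthonormalBasis (Fin n) ℝ V) (k : ℕ) :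
    averageEntry (gramMatrix e (2 * k)) = 1 / mu k n := by
  have : (Nat.doubleFactorial (2 * k - 1) : ℝ) ≠ 0 :=
    Nat.cast_ne_zero.2 (Nat.doubleFactorial_pos _).ne'
  simp only [averageEntry, sum_gramMatrix_row hn, Finset.sum_const, nsmul_eq_mul, Finset.card_univ,
    Pairing.card_eq, mu]
  field_simp

theorem theorem1 {V : Type*} [NormedAddCommGroup V] [InnerProductSpace ℝ V]
    [FiniteDimensional ℝ V] [MeasurableSpace V] [BorelSpace V]
    (n k : ℕ) (hn : 0 < n) (e : OrthonormalBasis (Fin n) ℝ V) :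
    -- (i) the projection of the Veronese surface onto the space of invariants
    ((invariantTensors V (2 * k)).starProjection '' veroneseSurface V (2 * k) =
      {mu k n • averageInvariant e (2 * k)}) ∧
    -- (ii) the row sums and the average entry of the Gram matrix
    ((∀ P : Pairing (2 * k), ∑ Q, gramMatrix e (2 * k) P Q = (stepProduct n k : ℝ)) ∧
      averageEntry (gramMatrix e (2 * k)) = 1 / mu k n) ∧
    -- (iii) the expectation of a random Veronese tensor
    (IsInvariantUnitLaw (uniformOnSphere V) ∧
      ∀ σ : MeasureTheory.Measure V, IsInvariantUnitLaw σ →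
        MeasureTheory.Integrable (fun x : V => tensorPow (2 * k) x) σ ∧
        ∫ x, tensorPow (2 * k) x ∂σ =
          (1 / (stepProduct n k : ℝ)) • ∑ P : Pairing (2 * k), standardInvariant e P ∧
        ∫ x, tensorPow (2 * k) x ∂σ = mu k n • averageInvariant e (2 * k) ∧
        ∫ x, tensorPow (2 * k) x ∂σ =
          (averageEntry (gramMatrix e (2 * k)))⁻¹ • averageInvariant e (2 * k)) := by
  have : Nontrivial V := ⟨e ⟨0, hn⟩, 0, e.toBasis.ne_zero _⟩
  have hu := isInvariantUnitLaw_uniformOnSphere V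
  refine ⟨?_, ⟨sum_gramMatrix_row hn e k, averageEntry_gramMatrix hn e k⟩, hu, fun σ hσ => ?_⟩
  · rw [veroneseSurface, Set.image_image, mu_smul_averageInvariant, ← hu.integral_tensorPow hn e]
    rw [Set.image_congr fun u h => hu.starProjection_tensorPow (2 * k) (mem_sphere_zero_iff_norm.1 h)]
    -- The projection is constant on the Veronese surface; its image is a point because the sphere
    -- is nonempty.
    exact Set.Nonempty.image_const (NormedSpace.sphere_nonempty.2 zero_le_one) _
  · rw [averageEntry_gramMatrix hn, one_div (mu k n), inv_inv, mu_smul_averageInvariant]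
    have h := hσ.integral_tensorPow hn e k
    exact ⟨hσ.integrable continuous_tensorPow, h, h, h⟩
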